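/- Let $F(Z)$ denote the set of all real-valued functions on a non-empty set $Z$, with pointwise operations and order. A Riesz space over $Z$ is a linear subspace $R\subset F(Z)$ with $|f|\in R$ for all $f\in R$. An integral on $R$ is a linear map $I:R\to\mathbb R$ such that $I(f)\le I(|f|)$ for all $f\in R$, and $\inf_n I(f_n)=0$ whenever $f_1,f_2,\ldots\in R$ satisfy $0\le f_{n+1}\le f_n$ for all $n$ and $\inf_n f_n=0$ pointwise. The upper integral of $f\in F(Z)$ is $I^*(f)=\inf\{\lim_n I(\varphi_n)\}\in[-\infty,\infty]$, the infimum being taken over all pointwise increasing sequences $(\varphi_n)$ in $R$ with $f\le\lim_n\varphi_n$ pointwise (the limits may be $+\infty$, and $\inf\emptyset=+\infty$). The function $f$ is called $I$-integrable if $I^*(f)=-I^*(-f)\in\mathbb R$. Let $\bar R$ be the set of all $I$-integrable $f\in F(Z)$, and put $\bar I(f)=I^*(f)$ for $f\in\bar R$. Theorem 2. Let $J:S\to\mathbb R$ and $K:T\to\mathbb R$ be integrals on Riesz spaces $S\subset F(X)$ and $T\subset F(Y)$, and let $\bar J:\bar S\to\mathbb R$ and $\bar K:\bar T\to\mathbb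 R$ be their extensions to the real-valued integrable functions, as above. Let $R=R(S\otimes T)\subset F(X\times Y)$ be the smallest Riesz space containing all functions $(f\otimes g)(x,y)=f(x)g(y)$ with $f\in S$, $g\in T$. There is exactly one integral $I:R\to\mathbb R$ with $I(f\otimes g)=J(f)K(g)$ for all $f\in S$, $g\in T$ (the product integral of $J$ and $K$). For $f\in F(X\times Y)$ write $f^x(y)=f_y(x)=f(x,y)$. Then for every $f\in R$: (a) $f^x\in\bar T$ for all $x\in X$, and the function $\bar Kf:x\mapsto\bar K(f^x)$ belongs to $\bar S$ (that is, $R\subset\bar S\ast\bar K$); (b) $f_y\in\bar S$ for all $y\in Y$, and the function $\bar Jf:y\mapsto\bar J(f_y)$ belongs to $\bar T$ (that is, $R\subset\bar J\ast\bar T$); (c) $I(f)=\bar J(\bar Kf)=\bar K(\bar Jf)$. -/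

import Mathlib

/-- A (Daniell) integral `I` on a Riesz space `R` of real-valued functions on `Z`.  That `R` is a
non-empty set of functions closed under sums and real multiples, on which `I` is additive and
homogeneous, is expressed by `R` being a submodule of `Z → ℝ` and `I` being a linear map.  Order,
absolute value and infima of functions are pointwise. -/
structure IsDaniellIntegral {Z : Type*} {R : Submodule ℝ (Z → ℝ)} (I : R →ₗ[ℝ] ℝ) : Prop where
  /-- the domain is closed under absolute values -/
  abs_mem : ∀ f : Z → ℝ, f ∈ R → |f| ∈ R
  /-- monotonicity -/
  le_abs : ∀ f : R, I f ≤ I ⟨|(f : Z → ℝ)|, abs_mem f f.2⟩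
  /-- continuity: if `0 ≤ f (n + 1) ≤ f n` and `inf f n = 0` pointwise, then `inf I (f n) = 0` -/
  continuity : ∀ f : ℕ → R, (∀ n z, 0 ≤ (f n : Z → ℝ) z) →
    (∀ n z, (f (n + 1) : Z → ℝ) z ≤ (f n : Z → ℝ) z) →
    (∀ z, IsGLB (Set.range fun n => (f n : Z → ℝ) z) 0) →
    IsGLB (Set.range fun n => I (f n)) 0

/-- The function `(x, y) ↦ f x * g y`. -/
def tensorFun {X Y : Type*} (f : X → ℝ) (g : Y → ℝ) : X × Y → ℝ := fun p => f p.1 * g p.2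

/-- The tensor product `S ⊗ T`: all finite sums of functions `f ⊗ g` with `f ∈ S`, `g ∈ T`. -/
def tensorSpace {X Y : Type*} (S : Submodule ℝ (X → ℝ)) (T : Submodule ℝ (Y → ℝ)) :
    Submodule ℝ (X × Y → ℝ) :=
  Submodule.span ℝ {h | ∃ f ∈ S, ∃ g ∈ T, h = tensorFun f g}

/-- The smallest Riesz space of functions on `Z` that contains the set `M`. -/
def rieszSpan {Z : Type*} (M : Set (Z → ℝ)) : Submodule ℝ (Z → ℝ) :=
  sInf {R : Submodule ℝ (Z → ℝ) | M ⊆ (R : Set (Z → ℝ)) ∧ ∀ f ∈ R, |f| ∈ R}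

/-- The Riesz space `R(S ⊗ T)` generated by the tensor product. -/
def productSpace {X Y : Type*} (S : Submodule ℝ (X → ℝ)) (T : Submodule ℝ (Y → ℝ)) :
    Submodule ℝ (X × Y → ℝ) :=
  rieszSpan (tensorSpace S T : Set (X × Y → ℝ))

theorem tensorFun_mem_productSpace {X Y : Type*} {S : Submodule ℝ (X → ℝ)}
    {T : Submodule ℝ (Y → ℝ)} {f : X → ℝ} {g : Y → ℝ} (hf : f ∈ S) (hg : g ∈ T) :
    tensorFun f g ∈ productSpace S T :=
  Submodule.mem_sInf.mpr fun _ hR => hR.1 (Submodule.subset_span ⟨f, hf, g, hg, rfl⟩)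

/-- `I` is the product integral of `J` and `K`: an integral on `R(S ⊗ T)` with
`I (f ⊗ g) = J f * K g` for all `f ∈ S`, `g ∈ T`. -/
structure IsProductIntegral {X Y : Type*} {S : Submodule ℝ (X → ℝ)} {T : Submodule ℝ (Y → ℝ)}
    (J : S →ₗ[ℝ] ℝ) (K : T →ₗ[ℝ] ℝ) (I : productSpace S T →ₗ[ℝ] ℝ) : Prop where
  isDaniellIntegral : IsDaniellIntegral I
  apply_tensor : ∀ (f : S) (g : T),
    I ⟨tensorFun f g, tensorFun_mem_productSpace f.2 g.2⟩ = J f * K g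

/-- Daniell's upper integral of `f`: the infimum of `I u = lim I (φ n)` over all upper functions
`u = lim φ n ≥ f`, i.e. pointwise limits, with values in `(-∞, ∞]`, of increasing sequences `φ` in
the domain of `I`.  The infimum of the empty set is `∞`. -/
noncomputable def upperIntegral {Z : Type*} {R : Submodule ℝ (Z → ℝ)} (I : R →ₗ[ℝ] ℝ)
    (f : Z → ℝ) : EReal :=
  sInf {a : EReal | ∃ φ : ℕ → R, (∀ n z, (φ n : Z → ℝ) z ≤ (φ (n + 1) : Z → ℝ) z) ∧
    (∀ z, (f z : EReal) ≤ ⨆ n, (((φ n : Z → ℝ) z : ℝ) : EReal)) ∧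
    a = ⨆ n, ((I (φ n) : ℝ) : EReal)}

/-- Daniell's lower integral of `f`. -/
noncomputable def lowerIntegral {Z : Type*} {R : Submodule ℝ (Z → ℝ)} (I : R →ₗ[ℝ] ℝ)
    (f : Z → ℝ) : EReal :=
  -upperIntegral I (-f)

/-- The real-valued `I`-integrable functions: upper and lower integral are finite and agree. -/
def integrableFunctions {Z : Type*} {R : Submodule ℝ (Z → ℝ)} (I : R →ₗ[ℝ] ℝ) :
    Set (Z → ℝ) :=
  {f | ∃ r : ℝ, upperIntegral I f = (r : EReal) ∧ lowerIntegral I f = (r : EReal)}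

/-- The extension of `I` to its integrable functions, the common value of upper and lower integral.
Only its values on `integrableFunctions I` are meaningful. -/
noncomputable def extendedIntegral {Z : Type*} {R : Submodule ℝ (Z → ℝ)} (I : R →ₗ[ℝ] ℝ)
    (f : Z → ℝ) : ℝ :=
  (upperIntegral I f).toReal

/-- For a functional `K` on `Y → ℝ`, the function `x ↦ K (f (x, ·))` on `X`. -/
def integrateSnd {X Y : Type*} (K : (Y → ℝ) → ℝ) (f : X × Y → ℝ) : X → ℝ :=
  fun x => K fun y => f (x, y)

/-- For a functional `J` on `X → ℝ`, the function `y ↦ J (f (·, y))` on `Y`. -/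
def integrateFst {X Y : Type*} (J : (X → ℝ) → ℝ) (f : X × Y → ℝ) : Y → ℝ :=
  fun y => J fun x => f (x, y)

/-- The set `S ∗ K` for a functional `K` with domain `T`: all `f` whose sections `f (x, ·)` lie in
`T` for every `x`, and for which `x ↦ K (f (x, ·))` lies in `S`. -/
def starSnd {X Y : Type*} (S : Set (X → ℝ)) (T : Set (Y → ℝ)) (K : (Y → ℝ) → ℝ) :
    Set (X × Y → ℝ) :=
  {f | (∀ x, (fun y => f (x, y)) ∈ T) ∧ integrateSnd K f ∈ S}

/-- The set `J ∗ T` for a functional `J` with domain `S`: all `f` whose sections `f (·, y)` lie in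
`S` for every `y`, and for which `y ↦ J (f (·, y))` lies in `T`. -/
def starFst {X Y : Type*} (S : Set (X → ℝ)) (J : (X → ℝ) → ℝ) (T : Set (Y → ℝ)) :
    Set (X × Y → ℝ) :=
  {f | (∀ y, (fun x => f (x, y)) ∈ S) ∧ integrateFst J f ∈ T}

/-! The core is an approximation theorem, `exists_tensor_approx`: each f in R(S ⊗ T) admits σ ∈ S, τ
∈ T with, for every ε > 0, some v ∈ S ⊗ T satisfying |f - v| ≤ ε σ ⊗ τ. Since S and T need not be
closed under products, f is divided by σ ⊗ τ. The quotients a = s/σ of functions of S with |s| ≤ σ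
lie in `relApprox S σ`, which is an algebra by the lattice form of Stone–Weierstrass. Sums of
products a ⊗ b therefore form an algebra of bounded functions, whose uniform closure is stable under
absolute values by Weierstrass. Multiplying by σ ⊗ τ leads back to S ⊗ T up to a relative error.

Sections of f lie in T and S themselves, and integrating v ± ε σ ⊗ τ in y traps the partial integral
of f between elements of S whose J-integrals are arbitrarily close (`IsSqueezed`). Such functions
are integrable, with the trapped number as integral. The product integral is then defined as the
iterated integral. Its continuity needs monotone convergence for squeezed functions only
(`IsSqueezed.isGLB_zero`). Any product integral agrees with both iterated integrals on S ⊗ T, hence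
on R(S ⊗ T) by the same trapping; this gives Fubini and uniqueness. -/

/-! ### Uniform closures of algebras of bounded functions -/

/-- The submodule of functions that are uniform limits of elements of `p`. -/
def uniformClosure {Z : Type*} (p : Submodule ℝ (Z → ℝ)) : Submodule ℝ (Z → ℝ) where
  carrier := {h | ∀ ε : ℝ, 0 < ε → ∃ k ∈ p, ∀ z, |h z - k z| ≤ ε}
  zero_mem' := fun ε hε => ⟨0, p.zero_mem, fun z => by simpa using hε.le⟩
  add_mem' := by
    intro a b ha hb ε hε
    obtain ⟨k, hk, hk'⟩ := ha (ε / 2) (by positivity)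
    obtain ⟨l, hl, hl'⟩ := hb (ε / 2) (by positivity)
    refine ⟨k + l, p.add_mem hk hl, fun z => ?_⟩
    have h1 := abs_le.1 (hk' z)
    have h2 := abs_le.1 (hl' z)
    simp only [Pi.add_apply]
    exact abs_le.2 ⟨by linarith, by linarith⟩
  smul_mem' := by
    intro c a ha ε hε
    -- Dividing by |c| + 1 instead of |c| covers c = 0.
    obtain ⟨k, hk, hk'⟩ := ha (ε / (|c| + 1)) (by positivity)
    refine ⟨c • k, p.smul_mem c hk, fun z => ?_⟩
    simp only [Pi.smul_apply, smul_eq_mul]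
    rw [← mul_sub, abs_mul]
    calc |c| * |a z - k z| ≤ (|c| + 1) * (ε / (|c| + 1)) := by
          gcongr
          · linarith
          · exact hk' z
      _ = ε := by field_simp

theorem le_uniformClosure {Z : Type*} (p : Submodule ℝ (Z → ℝ)) : p ≤ uniformClosure p :=
  fun h hh ε hε => ⟨h, hh, fun z => by simpa using hε.le⟩

/-- As `M` is closed under products, its span is already the subalgebra it generates. -/
theorem eval_comp_mem_span {Z : Type*} (M : Submonoid (Z → ℝ)) {h : Z → ℝ}
    (hh : h ∈ Submodule.span ℝ (M : Set (Z → ℝ))) (q : Polynomial ℝ) :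
    (fun z => q.eval (h z)) ∈ Submodule.span ℝ (M : Set (Z → ℝ)) := by
  have key : Subalgebra.toSubmodule (Algebra.adjoin ℝ (M : Set (Z → ℝ))) =
      Submodule.span ℝ (M : Set (Z → ℝ)) := by
    rw [Algebra.adjoin_eq_span, Submonoid.closure_eq]
  rw [← key, Subalgebra.mem_toSubmodule] at hh ⊢
  have h2 := (Polynomial.aeval
    (⟨h, hh⟩ : Algebra.adjoin ℝ (M : Set (Z → ℝ))) q).2
  rw [← Subalgebra.aeval_coe] at h2
  convert h2 using 1
  funext z
  simp [Polynomial.aeval_def, Polynomial.eval₂_eq_eval_map]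

/-- Uniform limits of an algebra of bounded functions are closed under absolute values. -/
theorem abs_mem_uniformClosure {Z : Type*} (M : Submonoid (Z → ℝ))
    (hM : ∀ h ∈ M, ∃ C : ℝ, ∀ z, |h z| ≤ C) {h : Z → ℝ}
    (hh : h ∈ uniformClosure (Submodule.span ℝ (M : Set (Z → ℝ)))) :
    |h| ∈ uniformClosure (Submodule.span ℝ (M : Set (Z → ℝ))) := by
  have bdd : ∀ k ∈ Submodule.span ℝ (M : Set (Z → ℝ)), ∃ C : ℝ, ∀ z, |k z| ≤ C := by
    intro k hk
    induction hk using Submodule.span_induction with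
    | mem k hk => exact hM k hk
    | zero => exact ⟨0, fun z => by simp⟩
    | add k l _ _ hk hl =>
      obtain ⟨C, hC⟩ := hk
      obtain ⟨D, hD⟩ := hl
      exact ⟨C + D, fun z => (abs_add_le _ _).trans (add_le_add (hC z) (hD z))⟩
    | smul c k _ hk =>
      obtain ⟨C, hC⟩ := hk
      refine ⟨|c| * C, fun z => ?_⟩
      simp only [Pi.smul_apply, smul_eq_mul, abs_mul]
      exact mul_le_mul_of_nonneg_left (hC z) (abs_nonneg c)
  intro ε hε
  obtain ⟨k, hk, hk'⟩ := hh (ε / 2) (by positivity)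
  obtain ⟨C, hC⟩ := bdd k hk
  -- Weierstrass: q approximates the absolute value on an interval containing the range of k.
  obtain ⟨q, hq⟩ := exists_polynomial_near_of_continuousOn (-C) C (fun t => |t|)
    continuous_abs.continuousOn (ε / 2) (by positivity)
  refine ⟨_, eval_comp_mem_span M hk q, fun z => ?_⟩
  have h1 := hq (k z) (abs_le.1 (hC z))
  have h2 := (abs_abs_sub_abs_le_abs_sub (h z) (k z)).trans (hk' z)
  rw [abs_sub_comm] at h1
  simp only [Pi.abs_apply]
  calc |(|h z| - q.eval (k z))| ≤ |(|h z| - |k z|)| + |(|k z| - q.eval (k z))| :=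
        abs_sub_le _ _ _
    _ ≤ ε := by linarith

/-! ### The algebra of relatively approximable functions -/

/-- The bounded functions `a` such that `σ * a` can be approximated by elements of `S`,
uniformly relative to `σ`. -/
def relApprox {X : Type*} (S : Submodule ℝ (X → ℝ)) (σ : X → ℝ) : Submodule ℝ (X → ℝ) where
  carrier := {a | (∃ C : ℝ, ∀ x, |a x| ≤ C) ∧
    ∀ ε : ℝ, 0 < ε → ∃ s ∈ S, ∀ x, |σ x * a x - s x| ≤ ε * |σ x|}
  zero_mem' := ⟨⟨0, fun x => by simp⟩, fun ε hε => ⟨0, S.zero_mem, fun x => by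
    simp only [Pi.zero_apply, mul_zero, sub_zero, abs_zero]; positivity⟩⟩
  add_mem' := by
    rintro a b ⟨⟨C, hC⟩, ha⟩ ⟨⟨D, hD⟩, hb⟩
    refine ⟨⟨C + D, fun z => (abs_add_le _ _).trans (add_le_add (hC z) (hD z))⟩, fun ε hε => ?_⟩
    obtain ⟨k, hk, hk'⟩ := ha (ε / 2) (by positivity)
    obtain ⟨l, hl, hl'⟩ := hb (ε / 2) (by positivity)
    refine ⟨k + l, S.add_mem hk hl, fun z => ?_⟩
    have h1 := abs_le.1 (hk' z)
    have h2 := abs_le.1 (hl' z)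
    simp only [Pi.add_apply, mul_add]
    exact abs_le.2 ⟨by linarith, by linarith⟩
  smul_mem' := by
    rintro c a ⟨⟨C, hC⟩, ha⟩
    refine ⟨⟨|c| * C, fun z => ?_⟩, fun ε hε => ?_⟩
    · simp only [Pi.smul_apply, smul_eq_mul, abs_mul]
      exact mul_le_mul_of_nonneg_left (hC z) (abs_nonneg c)
    obtain ⟨k, hk, hk'⟩ := ha (ε / (|c| + 1)) (by positivity)
    refine ⟨c • k, S.smul_mem c hk, fun z => ?_⟩
    simp only [Pi.smul_apply, smul_eq_mul]
    rw [mul_left_comm, ← mul_sub, abs_mul]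
    calc |c| * |σ z * a z - k z| ≤ (|c| + 1) * (ε / (|c| + 1) * |σ z|) := by
          gcongr
          · linarith
          · exact hk' z
      _ = ε * |σ z| := by field_simp

theorem relApprox_of_uniform {X : Type*} {S : Submodule ℝ (X → ℝ)} {σ a : X → ℝ}
    (h : ∀ ε : ℝ, 0 < ε → ∃ b ∈ relApprox S σ, ∀ x, |a x - b x| ≤ ε) : a ∈ relApprox S σ := by
  refine ⟨?_, fun ε hε => ?_⟩
  · obtain ⟨b, ⟨⟨C, hC⟩, -⟩, hb⟩ := h 1 one_pos
    refine ⟨C + 1, fun x => ?_⟩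
    have h1 := abs_le.1 (hC x)
    have h2 := abs_le.1 (hb x)
    exact abs_le.2 ⟨by linarith, by linarith⟩
  · obtain ⟨b, ⟨-, hb⟩, hab⟩ := h (ε / 2) (by positivity)
    obtain ⟨s, hs, hbs⟩ := hb (ε / 2) (by positivity)
    refine ⟨s, hs, fun x => ?_⟩
    calc |σ x * a x - s x| ≤ |σ x * a x - σ x * b x| + |σ x * b x - s x| := abs_sub_le _ _ _
      _ ≤ |σ x| * (ε / 2) + ε / 2 * |σ x| := by
          rw [← mul_sub, abs_mul]
          exact add_le_add (mul_le_mul_of_nonneg_left (hab x) (abs_nonneg _)) (hbs x)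
      _ = ε * |σ x| := by ring

theorem one_mem_relApprox {X : Type*} {S : Submodule ℝ (X → ℝ)} {σ : X → ℝ} (hσ : σ ∈ S) :
    1 ∈ relApprox S σ :=
  ⟨⟨1, fun x => by simp⟩, fun ε hε => ⟨σ, hσ, fun x => by
    simp only [Pi.one_apply, mul_one, sub_self, abs_zero]; positivity⟩⟩

theorem abs_mem_relApprox {X : Type*} {S : Submodule ℝ (X → ℝ)} (hS : ∀ f ∈ S, |f| ∈ S)
    {σ a : X → ℝ} (hσ : 0 ≤ σ) (ha : a ∈ relApprox S σ) : |a| ∈ relApprox S σ := by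
  obtain ⟨⟨C, hC⟩, ha⟩ := ha
  refine ⟨⟨C, fun x => by simpa using hC x⟩, fun ε hε => ?_⟩
  obtain ⟨s, hs, has⟩ := ha ε hε
  refine ⟨|s|, hS s hs, fun x => ?_⟩
  have h1 := (abs_abs_sub_abs_le_abs_sub (σ x * a x) (s x)).trans (has x)
  have h2 : |σ x| = σ x := abs_of_nonneg (hσ x)
  simpa only [Pi.abs_apply, abs_mul, h2] using h1

/-- Composition with a turns the lattice structure of `relApprox S σ` into a lattice of continuous
functions on [-C, C], dense by Stone–Weierstrass; so the square function is a uniform limit of it.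
-/
theorem sq_mem_relApprox {X : Type*} {S : Submodule ℝ (X → ℝ)} (hS : ∀ f ∈ S, |f| ∈ S)
    {σ a : X → ℝ} (hσS : σ ∈ S) (hσ : 0 ≤ σ) (ha : a ∈ relApprox S σ) :
    a * a ∈ relApprox S σ := by
  obtain ⟨C, hC⟩ := ha.1
  have hI : ∀ x, a x ∈ Set.Icc (-C) C := fun x => abs_le.1 (hC x)
  let L : Set C(Set.Icc (-C) C, ℝ) := {f | (fun x => f ⟨a x, hI x⟩) ∈ relApprox S σ}
  have affine : ∀ c d : ℝ, (fun x => c * a x + d) ∈ relApprox S σ := fun c d => by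
    convert (relApprox S σ).add_mem ((relApprox S σ).smul_mem c ha)
      ((relApprox S σ).smul_mem d (one_mem_relApprox hσS)) using 1
    ext x; simp
  have hL : closure L = ⊤ := by
    refine ContinuousMap.sublattice_closure_eq_top L ⟨0, (relApprox S σ).zero_mem⟩ ?_ ?_ ?_
    · intro f hf g hg
      have h : f ⊓ g = (2⁻¹ : ℝ) • (f + g - |g - f|) := inf_eq_half_smul_add_sub_abs_sub' ℝ f g
      rw [h]
      exact (relApprox S σ).smul_mem _ ((relApprox S σ).sub_mem ((relApprox S σ).add_mem hf hg)
        (abs_mem_relApprox hS hσ ((relApprox S σ).sub_mem hg hf)))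
    · intro f hf g hg
      have h : f ⊔ g = (2⁻¹ : ℝ) • (f + g + |g - f|) := sup_eq_half_smul_add_add_abs_sub' ℝ f g
      rw [h]
      exact (relApprox S σ).smul_mem _ ((relApprox S σ).add_mem ((relApprox S σ).add_mem hf hg)
        (abs_mem_relApprox hS hσ ((relApprox S σ).sub_mem hg hf)))
    -- Affine functions of a are available because `relApprox S σ` contains 1; they interpolate any
    -- values at two points.
    · intro v x y
      by_cases hxy : x = y
      · subst hxy
        refine ⟨ContinuousMap.const _ (v x), ?_, rfl, rfl⟩
        have h := affine 0 (v x)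
        simp only [zero_mul, zero_add] at h
        exact h
      · have hne : (y : ℝ) - x ≠ 0 := sub_ne_zero.2 fun h => hxy (Subtype.ext h.symm)
        refine ⟨⟨fun t => (v y - v x) / (y - x) * (t : ℝ) +
          (v x - (v y - v x) / (y - x) * x), by fun_prop⟩, affine _ _, ?_, ?_⟩
        · simp
        · simp only [ContinuousMap.coe_mk]
          field_simp
          ring
  let q : C(Set.Icc (-C) C, ℝ) := ⟨fun t => (t : ℝ) * t, by fun_prop⟩
  have hq : q ∈ closure L := hL ▸ Set.mem_univ q
  refine relApprox_of_uniform fun ε hε => ?_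
  obtain ⟨f, hf, hqf⟩ := Metric.mem_closure_iff.1 hq ε hε
  refine ⟨_, hf, fun x => ?_⟩
  have := (ContinuousMap.dist_apply_le_dist (f := q) (g := f) ⟨a x, hI x⟩).trans hqf.le
  rwa [Real.dist_eq] at this

/-- Polarization reduces products to squares. -/
theorem mul_mem_relApprox {X : Type*} {S : Submodule ℝ (X → ℝ)} (hS : ∀ f ∈ S, |f| ∈ S)
    {σ a b : X → ℝ} (hσS : σ ∈ S) (hσ : 0 ≤ σ) (ha : a ∈ relApprox S σ)
    (hb : b ∈ relApprox S σ) : a * b ∈ relApprox S σ := by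
  have h : a * b = (2⁻¹ : ℝ) • ((a + b) * (a + b) - a * a - b * b) := by
    ext x
    simp only [Pi.mul_apply, Pi.smul_apply, Pi.sub_apply, Pi.add_apply, smul_eq_mul]
    ring
  rw [h]
  have sq := fun {c} hc => sq_mem_relApprox hS (a := c) hσS hσ hc
  exact Submodule.smul_mem _ _ (Submodule.sub_mem _ (Submodule.sub_mem _
    (sq (Submodule.add_mem _ ha hb)) (sq ha)) (sq hb))

/-- Where σ vanishes so does f, so the convention f/0 = 0 keeps σ · (f/σ) = f everywhere. -/
theorem div_mem_relApprox {X : Type*} {S : Submodule ℝ (X → ℝ)} {σ f : X → ℝ} (hf : f ∈ S)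
    (h : |f| ≤ σ) : (fun x => f x / σ x) ∈ relApprox S σ := by
  have hσ : ∀ x, 0 ≤ σ x := fun x => (abs_nonneg _).trans (h x)
  refine ⟨⟨1, fun x => ?_⟩, fun ε hε => ⟨f, hf, fun x => ?_⟩⟩
  · rw [abs_div, abs_of_nonneg (hσ x)]
    exact div_le_one_of_le₀ (h x) (hσ x)
  · rw [mul_div_cancel_of_imp', sub_self, abs_zero]
    · positivity
    · intro h0
      have := h x
      rw [h0] at this
      exact abs_nonpos_iff.1 this

/-! ### Approximation by the tensor product -/

/-- The monoid of products `a ⊗ b` of functions in `relApprox S σ` and `relApprox T τ`. -/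
def tensorMonoid {X Y : Type*} {S : Submodule ℝ (X → ℝ)} {T : Submodule ℝ (Y → ℝ)}
    (hS : ∀ f ∈ S, |f| ∈ S) (hT : ∀ f ∈ T, |f| ∈ T) {σ : X → ℝ} {τ : Y → ℝ}
    (hσS : σ ∈ S) (hσ : 0 ≤ σ) (hτT : τ ∈ T) (hτ : 0 ≤ τ) : Submonoid (X × Y → ℝ) where
  carrier := {h | ∃ a ∈ relApprox S σ, ∃ b ∈ relApprox T τ, h = tensorFun a b}
  one_mem' := ⟨1, one_mem_relApprox hσS, 1, one_mem_relApprox hτT, by ext; simp [tensorFun]⟩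
  mul_mem' := by
    rintro _ _ ⟨a, ha, b, hb, rfl⟩ ⟨c, hc, d, hd, rfl⟩
    refine ⟨a * c, mul_mem_relApprox hS hσS hσ ha hc, b * d, mul_mem_relApprox hT hτT hτ hb hd, ?_⟩
    ext p
    simp only [tensorFun, Pi.mul_apply]
    ring

section ProductApprox

variable {X Y : Type*} {S : Submodule ℝ (X → ℝ)} {T : Submodule ℝ (Y → ℝ)}
  (hS : ∀ f ∈ S, |f| ∈ S) (hT : ∀ f ∈ T, |f| ∈ T)

theorem bounded_of_mem_tensorMonoid {σ : X → ℝ} {τ : Y → ℝ}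
    (hσS : σ ∈ S) (hσ : 0 ≤ σ) (hτT : τ ∈ T) (hτ : 0 ≤ τ) {h : X × Y → ℝ}
    (hh : h ∈ tensorMonoid hS hT hσS hσ hτT hτ) : ∃ C : ℝ, ∀ z, |h z| ≤ C := by
  obtain ⟨a, ⟨⟨C, hC⟩, -⟩, b, ⟨⟨D, hD⟩, -⟩, rfl⟩ := hh
  refine ⟨C * D, fun p => ?_⟩
  rw [tensorFun, abs_mul]
  exact mul_le_mul (hC _) (hD _) (abs_nonneg _) ((abs_nonneg _).trans (hC p.1))

theorem exists_tensor_approx_of_mem_tensorMonoid {σ : X → ℝ} {τ : Y → ℝ}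
    (hσS : σ ∈ S) (hσ : 0 ≤ σ) (hτT : τ ∈ T) (hτ : 0 ≤ τ) {h : X × Y → ℝ}
    (hh : h ∈ tensorMonoid hS hT hσS hσ hτT hτ) {ε : ℝ} (hε : 0 < ε) :
    ∃ v ∈ tensorSpace S T, ∀ p, |tensorFun σ τ p * h p - v p| ≤ ε * tensorFun σ τ p := by
  obtain ⟨a, ⟨⟨C, hC⟩, ha⟩, b, ⟨⟨D, hD⟩, hb⟩, rfl⟩ := hh
  -- The two tolerances make each term of σa ⊗ τb - s ⊗ t = (σa - s) ⊗ τb + s ⊗ (τb - t) at most ε/2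
  -- · σ ⊗ τ, using |τb| ≤ (|D| + 1)τ and |s| ≤ (|C| + ε)σ.
  obtain ⟨s, hs, has⟩ := ha (ε / (2 * (|D| + 1))) (by positivity)
  obtain ⟨δ, hδ, hδ'⟩ : ∃ δ : ℝ, 0 < δ ∧ (|C| + ε) * δ ≤ ε / 2 :=
    ⟨ε / 2 / (|C| + ε), by positivity, by field_simp; rfl⟩
  obtain ⟨t, ht, hbt⟩ := hb δ hδ
  refine ⟨tensorFun s t, Submodule.subset_span ⟨s, hs, t, ht, rfl⟩, fun p => ?_⟩
  have hσ' : 0 ≤ σ p.1 := hσ p.1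
  have hτ' : 0 ≤ τ p.2 := hτ p.2
  have h1 := has p.1
  have h2 := hbt p.2
  rw [abs_of_nonneg hσ'] at h1
  rw [abs_of_nonneg hτ'] at h2
  have hb' : |τ p.2 * b p.2| ≤ τ p.2 * (|D| + 1) := by
    rw [abs_mul, abs_of_nonneg hτ']
    exact mul_le_mul_of_nonneg_left (by linarith [hD p.2, le_abs_self D]) hτ'
  have hε' : ε / (2 * (|D| + 1)) ≤ ε := by
    apply div_le_self hε.le
    linarith [abs_nonneg D]
  have hs' : |s p.1| ≤ (|C| + ε) * σ p.1 := by
    have h3 : |σ p.1 * a p.1| ≤ σ p.1 * |C| := by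
      rw [abs_mul, abs_of_nonneg hσ']
      exact mul_le_mul_of_nonneg_left ((hC p.1).trans (le_abs_self C)) hσ'
    have h4 := mul_le_mul_of_nonneg_right hε' hσ'
    have h5 := abs_sub_abs_le_abs_sub (s p.1) (σ p.1 * a p.1)
    rw [abs_sub_comm] at h5
    linarith
  simp only [tensorFun]
  calc |σ p.1 * τ p.2 * (a p.1 * b p.2) - s p.1 * t p.2|
      = |(σ p.1 * a p.1 - s p.1) * (τ p.2 * b p.2) +
          s p.1 * (τ p.2 * b p.2 - t p.2)| := by congr 1; ring
    _ ≤ |σ p.1 * a p.1 - s p.1| * |τ p.2 * b p.2| + |s p.1| * |τ p.2 * b p.2 - t p.2| := by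
        rw [← abs_mul, ← abs_mul]; exact abs_add_le _ _
    _ ≤ ε / (2 * (|D| + 1)) * σ p.1 * (τ p.2 * (|D| + 1)) +
          (|C| + ε) * σ p.1 * (δ * τ p.2) := by gcongr
    _ = ε / 2 * (σ p.1 * τ p.2) + (|C| + ε) * δ * (σ p.1 * τ p.2) := by field_simp
    _ ≤ ε / 2 * (σ p.1 * τ p.2) + ε / 2 * (σ p.1 * τ p.2) := by gcongr
    _ = ε * (σ p.1 * τ p.2) := by ring

theorem exists_tensor_approx_of_mem_uniformClosure {σ : X → ℝ} {τ : Y → ℝ}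
    (hσS : σ ∈ S) (hσ : 0 ≤ σ) (hτT : τ ∈ T) (hτ : 0 ≤ τ) {h : X × Y → ℝ}
    (hh : h ∈ uniformClosure (Submodule.span ℝ
      (tensorMonoid hS hT hσS hσ hτT hτ : Set (X × Y → ℝ)))) {ε : ℝ} (hε : 0 < ε) :
    ∃ v ∈ tensorSpace S T, ∀ p, |tensorFun σ τ p * h p - v p| ≤ ε * tensorFun σ τ p := by
  have hnn : ∀ p, 0 ≤ tensorFun σ τ p := fun p => mul_nonneg (hσ p.1) (hτ p.2)
  have key : ∀ k ∈ Submodule.span ℝ (tensorMonoid hS hT hσS hσ hτT hτ : Set (X × Y → ℝ)),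
      ∀ ε : ℝ, 0 < ε →
      ∃ v ∈ tensorSpace S T, ∀ p, |tensorFun σ τ p * k p - v p| ≤ ε * tensorFun σ τ p := by
    intro k hk
    induction hk using Submodule.span_induction with
    | mem k hk =>
      exact fun ε hε => exists_tensor_approx_of_mem_tensorMonoid hS hT hσS hσ hτT hτ hk hε
    | zero => exact fun ε hε => ⟨0, Submodule.zero_mem _, fun p => by
        simpa using mul_nonneg hε.le (hnn p)⟩
    | add k l _ _ hk hl =>
      intro ε hε
      obtain ⟨v, hv, hv'⟩ := hk (ε / 2) (by positivity)
      obtain ⟨w, hw, hw'⟩ := hl (ε / 2) (by positivity)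
      refine ⟨v + w, Submodule.add_mem _ hv hw, fun p => ?_⟩
      have h1 := abs_le.1 (hv' p)
      have h2 := abs_le.1 (hw' p)
      simp only [Pi.add_apply, mul_add]
      exact abs_le.2 ⟨by linarith, by linarith⟩
    | smul c k _ hk =>
      intro ε hε
      obtain ⟨v, hv, hv'⟩ := hk (ε / (|c| + 1)) (by positivity)
      refine ⟨c • v, Submodule.smul_mem _ c hv, fun p => ?_⟩
      simp only [Pi.smul_apply, smul_eq_mul]
      rw [mul_left_comm, ← mul_sub, abs_mul]
      calc |c| * |tensorFun σ τ p * k p - v p|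
          ≤ (|c| + 1) * (ε / (|c| + 1) * tensorFun σ τ p) := by
            gcongr
            · linarith
            · exact hv' p
        _ = ε * tensorFun σ τ p := by field_simp
  obtain ⟨k, hk, hk'⟩ := hh (ε / 2) (by positivity)
  obtain ⟨v, hv, hv'⟩ := key k hk (ε / 2) (by positivity)
  refine ⟨v, hv, fun p => ?_⟩
  calc |tensorFun σ τ p * h p - v p|
      ≤ |tensorFun σ τ p * h p - tensorFun σ τ p * k p| + |tensorFun σ τ p * k p - v p| :=
        abs_sub_le _ _ _
    _ ≤ tensorFun σ τ p * (ε / 2) + ε / 2 * tensorFun σ τ p := by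
        rw [← mul_sub, abs_mul, abs_of_nonneg (hnn p)]
        exact add_le_add (mul_le_mul_of_nonneg_left (hk' p) (hnn p)) (hv' p)
    _ = ε * tensorFun σ τ p := by ring

/-- The functions that, divided by `σ ⊗ τ`, become uniform limits of sums of products `a ⊗ b`, for
all sufficiently large `σ` and `τ`. -/
def eventuallyTensor : Submodule ℝ (X × Y → ℝ) where
  carrier := {f | ∃ σ₀ ∈ S, ∃ τ₀ ∈ T, 0 ≤ σ₀ ∧ 0 ≤ τ₀ ∧
    ∀ (σ : X → ℝ) (τ : Y → ℝ) (hσS : σ ∈ S) (hσ : 0 ≤ σ) (hτT : τ ∈ T) (hτ : 0 ≤ τ),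
      σ₀ ≤ σ → τ₀ ≤ τ → ∃ h ∈ uniformClosure (Submodule.span ℝ
        (tensorMonoid hS hT hσS hσ hτT hτ : Set (X × Y → ℝ))), f = tensorFun σ τ * h}
  zero_mem' := ⟨0, S.zero_mem, 0, T.zero_mem, le_rfl, le_rfl,
    fun _ _ _ _ _ _ _ _ => ⟨0, Submodule.zero_mem _, by simp⟩⟩
  add_mem' := by
    rintro f g ⟨σ₁, hσ₁, τ₁, hτ₁, hσ₁', hτ₁', hf⟩ ⟨σ₂, hσ₂, τ₂, hτ₂, hσ₂', hτ₂', hg⟩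
    -- Quantifying over all large σ, τ lets both summands be divided by the same σ ⊗ τ.
    refine ⟨σ₁ + σ₂, S.add_mem hσ₁ hσ₂, τ₁ + τ₂, T.add_mem hτ₁ hτ₂, add_nonneg hσ₁' hσ₂',
      add_nonneg hτ₁' hτ₂', fun σ τ hσS hσ hτT hτ h1 h2 => ?_⟩
    obtain ⟨a, ha, rfl⟩ := hf σ τ hσS hσ hτT hτ ((le_add_of_nonneg_right hσ₂').trans h1)
      ((le_add_of_nonneg_right hτ₂').trans h2)
    obtain ⟨b, hb, rfl⟩ := hg σ τ hσS hσ hτT hτ ((le_add_of_nonneg_left hσ₁').trans h1)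
      ((le_add_of_nonneg_left hτ₁').trans h2)
    exact ⟨a + b, Submodule.add_mem _ ha hb, by ring⟩
  smul_mem' := by
    rintro c f ⟨σ₁, hσ₁, τ₁, hτ₁, hσ₁', hτ₁', hf⟩
    refine ⟨σ₁, hσ₁, τ₁, hτ₁, hσ₁', hτ₁', fun σ τ hσS hσ hτT hτ h1 h2 => ?_⟩
    obtain ⟨a, ha, rfl⟩ := hf σ τ hσS hσ hτT hτ h1 h2
    exact ⟨c • a, Submodule.smul_mem _ c ha, (mul_smul_comm _ _ _).symm⟩

theorem tensorFun_mem_eventuallyTensor {f : X → ℝ} {g : Y → ℝ} (hf : f ∈ S) (hg : g ∈ T) :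
    tensorFun f g ∈ eventuallyTensor hS hT := by
  refine ⟨|f|, hS f hf, |g|, hT g hg, abs_nonneg f, abs_nonneg g,
    fun σ τ hσS hσ hτT hτ h1 h2 => ⟨_, le_uniformClosure _ (Submodule.subset_span
      ⟨_, div_mem_relApprox hf h1, _, div_mem_relApprox hg h2, rfl⟩), ?_⟩⟩
  ext p
  have e1 : f p.1 = σ p.1 * (f p.1 / σ p.1) := by
    rw [mul_div_cancel_of_imp']
    intro h0
    have := h1 p.1
    rw [h0] at this
    exact abs_nonpos_iff.1 this
  have e2 : g p.2 = τ p.2 * (g p.2 / τ p.2) := by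
    rw [mul_div_cancel_of_imp']
    intro h0
    have := h2 p.2
    rw [h0] at this
    exact abs_nonpos_iff.1 this
  simp only [tensorFun, Pi.mul_apply]
  rw [mul_mul_mul_comm, ← e1, ← e2]

theorem abs_mem_eventuallyTensor {f : X × Y → ℝ} (hf : f ∈ eventuallyTensor hS hT) :
    |f| ∈ eventuallyTensor hS hT := by
  obtain ⟨σ₁, hσ₁, τ₁, hτ₁, hσ₁', hτ₁', hf⟩ := hf
  refine ⟨σ₁, hσ₁, τ₁, hτ₁, hσ₁', hτ₁', fun σ τ hσS hσ hτT hτ h1 h2 => ?_⟩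
  obtain ⟨a, ha, rfl⟩ := hf σ τ hσS hσ hτT hτ h1 h2
  refine ⟨|a|, abs_mem_uniformClosure _
    (fun h hh => bounded_of_mem_tensorMonoid hS hT hσS hσ hτT hτ hh) ha, ?_⟩
  ext p
  have : 0 ≤ tensorFun σ τ p := mul_nonneg (hσ p.1) (hτ p.2)
  simp only [Pi.abs_apply, Pi.mul_apply, abs_mul, abs_of_nonneg this]

end ProductApprox

/-- Every function in the product space is a limit of elements of the tensor product, uniformly
relative to a fixed function `σ ⊗ τ`. -/
theorem exists_tensor_approx {X Y : Type*} {S : Submodule ℝ (X → ℝ)} {T : Submodule ℝ (Y → ℝ)}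
    (hS : ∀ f ∈ S, |f| ∈ S) (hT : ∀ f ∈ T, |f| ∈ T) {f : X × Y → ℝ} (hf : f ∈ productSpace S T) :
    ∃ σ ∈ S, ∃ τ ∈ T, 0 ≤ σ ∧ 0 ≤ τ ∧ ∀ ε : ℝ, 0 < ε →
      ∃ v ∈ tensorSpace S T, |f - v| ≤ ε • tensorFun σ τ := by
  -- Minimality: `eventuallyTensor` is a Riesz space containing S ⊗ T.
  have hle : productSpace S T ≤ eventuallyTensor hS hT := by
    refine sInf_le ⟨?_, fun g hg => abs_mem_eventuallyTensor hS hT hg⟩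
    refine Submodule.span_le.2 ?_
    rintro _ ⟨a, ha, b, hb, rfl⟩
    exact tensorFun_mem_eventuallyTensor hS hT ha hb
  obtain ⟨σ, hσS, τ, hτT, hσ, hτ, h⟩ := hle hf
  obtain ⟨a, ha, rfl⟩ := h σ τ hσS hσ hτT hτ le_rfl le_rfl
  refine ⟨σ, hσS, τ, hτT, hσ, hτ, fun ε hε => ?_⟩
  obtain ⟨v, hv, hv'⟩ := exists_tensor_approx_of_mem_uniformClosure hS hT hσS hσ hτT hτ ha hε
  exact ⟨v, hv, hv'⟩
-- Elementary properties of Daniell integrals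
namespace IsDaniellIntegral

variable {Z : Type*} {R : Submodule ℝ (Z → ℝ)} {I : R →ₗ[ℝ] ℝ}

theorem nonneg (hI : IsDaniellIntegral I) {f : R} (hf : 0 ≤ (f : Z → ℝ)) : 0 ≤ I f := by
  have h := hI.le_abs (-f)
  have e : (⟨|((-f : R) : Z → ℝ)|, hI.abs_mem _ (-f).2⟩ : R) = f :=
    Subtype.ext (by simp [abs_of_nonneg hf])
  rw [e, map_neg] at h
  linarith

theorem mono (hI : IsDaniellIntegral I) {f g : R} (h : (f : Z → ℝ) ≤ g) : I f ≤ I g := by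
  have h1 := hI.nonneg (f := g - f) (by simpa using h)
  rw [map_sub] at h1
  linarith

theorem sup_mem (hI : IsDaniellIntegral I) {f g : Z → ℝ} (hf : f ∈ R) (hg : g ∈ R) :
    f ⊔ g ∈ R := by
  rw [sup_eq_half_smul_add_add_abs_sub' ℝ]
  exact R.smul_mem _ (R.add_mem (R.add_mem hf hg) (hI.abs_mem _ (R.sub_mem hg hf)))

theorem inf_mem (hI : IsDaniellIntegral I) {f g : Z → ℝ} (hf : f ∈ R) (hg : g ∈ R) :
    f ⊓ g ∈ R := by
  rw [inf_eq_half_smul_add_sub_abs_sub' ℝ]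
  exact R.smul_mem _ (R.sub_mem (R.add_mem hf hg) (hI.abs_mem _ (R.sub_mem hg hf)))

/-- An increasing sequence in the domain whose supremum dominates `s` has integrals whose supremum
dominates that of `s`. -/
theorem le_iSup_of_le_iSup (hI : IsDaniellIntegral I) (s : R) {φ : ℕ → R}
    (hφ : ∀ n z, (φ n : Z → ℝ) z ≤ (φ (n + 1) : Z → ℝ) z)
    (hs : ∀ z, ((s : Z → ℝ) z : EReal) ≤ ⨆ n, (((φ n : Z → ℝ) z : ℝ) : EReal)) :
    ((I s : ℝ) : EReal) ≤ ⨆ n, ((I (φ n) : ℝ) : EReal) := by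
  -- The positive parts (s - φ n)⁺ decrease to 0, and I s - I (φ n) ≤ I (ψ n).
  let ψ : ℕ → R := fun n => ⟨((s - φ n : R) : Z → ℝ) ⊔ 0, hI.sup_mem (s - φ n).2 R.zero_mem⟩
  have hψ : ∀ n z, (ψ n : Z → ℝ) z = max ((s : Z → ℝ) z - (φ n : Z → ℝ) z) 0 := fun _ _ => rfl
  have hglb := hI.continuity ψ (fun n z => by rw [hψ]; exact le_max_right _ _)
    (fun n z => by rw [hψ, hψ]; exact max_le_max (sub_le_sub_left (hφ n z) _) le_rfl) (fun z => by
      refine ⟨?_, fun b hb => ?_⟩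
      · rintro _ ⟨n, rfl⟩
        exact le_max_right _ _
      · by_contra! hb0
        have hlt : (((s : Z → ℝ) z - b : ℝ) : EReal) < ⨆ n, (((φ n : Z → ℝ) z : ℝ) : EReal) :=
          lt_of_lt_of_le (EReal.coe_lt_coe_iff.2 (by linarith)) (hs z)
        obtain ⟨n, hn⟩ := lt_iSup_iff.1 hlt
        have hn' := EReal.coe_lt_coe_iff.1 hn
        have h1 : b ≤ max ((s : Z → ℝ) z - (φ n : Z → ℝ) z) 0 := hb ⟨n, rfl⟩
        rcases le_max_iff.1 h1 with h2 | h2 <;> linarith)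
  refine EReal.le_of_forall_lt_iff_le.1 fun r hr => ?_
  have hr' : ∀ n, I (φ n) ≤ r := fun n =>
    EReal.coe_le_coe_iff.1 ((le_iSup (fun n => ((I (φ n) : ℝ) : EReal)) n).trans hr.le)
  have h2 : I s - r ≤ 0 := hglb.2 (by
    rintro _ ⟨n, rfl⟩
    have h3 : I (s - φ n) ≤ I (ψ n) := hI.mono fun z => le_max_left _ _
    rw [map_sub] at h3
    have := hr' n
    simp only
    linarith)
  exact EReal.coe_le_coe_iff.2 (by linarith)

end IsDaniellIntegral

/-! ### Squeezed functions and their integrals -/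

/-- `g` can be squeezed between elements of the domain of `I` whose integrals are close to `r`. -/
def IsSqueezed {Z : Type*} {R : Submodule ℝ (Z → ℝ)} (I : R →ₗ[ℝ] ℝ) (g : Z → ℝ) (r : ℝ) : Prop :=
  ∀ ε : ℝ, 0 < ε → ∃ s t : R, (s : Z → ℝ) ≤ g ∧ g ≤ t ∧ r - ε ≤ I s ∧ I t ≤ r + ε

namespace IsSqueezed

variable {Z : Type*} {R : Submodule ℝ (Z → ℝ)} {I : R →ₗ[ℝ] ℝ} {g g' : Z → ℝ} {r r' : ℝ}

theorem of_mem (f : R) : IsSqueezed I f (I f) :=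
  fun ε hε => ⟨f, f, le_rfl, le_rfl, by linarith, by linarith⟩

theorem add (h : IsSqueezed I g r) (h' : IsSqueezed I g' r') :
    IsSqueezed I (g + g') (r + r') := by
  intro ε hε
  obtain ⟨s, t, hs, ht, h1, h2⟩ := h (ε / 2) (by positivity)
  obtain ⟨s', t', hs', ht', h1', h2'⟩ := h' (ε / 2) (by positivity)
  refine ⟨s + s', t + t', add_le_add hs hs', add_le_add ht ht', ?_, ?_⟩ <;> rw [map_add] <;>
    linarith

theorem neg (h : IsSqueezed I g r) : IsSqueezed I (-g) (-r) := by
  intro ε hε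
  obtain ⟨s, t, hs, ht, h1, h2⟩ := h ε hε
  refine ⟨-t, -s, neg_le_neg ht, neg_le_neg hs, ?_, ?_⟩ <;> rw [map_neg] <;> linarith

theorem smul_of_nonneg (h : IsSqueezed I g r) {c : ℝ} (hc : 0 ≤ c) :
    IsSqueezed I (c • g) (c * r) := by
  intro ε hε
  obtain ⟨s, t, hs, ht, h1, h2⟩ := h (ε / (c + 1)) (by positivity)
  have hε' : c * (ε / (c + 1)) ≤ ε := by
    calc c * (ε / (c + 1)) ≤ (c + 1) * (ε / (c + 1)) := by gcongr; linarith
      _ = ε := by field_simp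
  refine ⟨c • s, c • t, smul_le_smul_of_nonneg_left hs hc, smul_le_smul_of_nonneg_left ht hc,
    ?_, ?_⟩ <;> rw [map_smul, smul_eq_mul]
  · nlinarith [mul_le_mul_of_nonneg_left h1 hc]
  · nlinarith [mul_le_mul_of_nonneg_left h2 hc]

theorem smul (h : IsSqueezed I g r) (c : ℝ) : IsSqueezed I (c • g) (c * r) := by
  rcases le_total 0 c with hc | hc
  · exact h.smul_of_nonneg hc
  · simpa using (h.smul_of_nonneg (neg_nonneg.2 hc)).neg

theorem mono (hI : IsDaniellIntegral I) (h : IsSqueezed I g r) (h' : IsSqueezed I g' r')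
    (hg : g ≤ g') : r ≤ r' := by
  refine le_of_forall_pos_le_add fun ε hε => ?_
  obtain ⟨s, -, hs, -, h1, -⟩ := h (ε / 2) (by positivity)
  obtain ⟨-, t, -, ht, -, h2⟩ := h' (ε / 2) (by positivity)
  have := hI.mono ((hs.trans hg).trans ht)
  linarith

/-- Constant sequences at majorants bound the upper integral from above; comparing admissible
sequences with minorants bounds it from below. -/
theorem upperIntegral_eq (hI : IsDaniellIntegral I) (h : IsSqueezed I g r) :
    upperIntegral I g = (r : EReal) := by
  apply le_antisymm
  · refine EReal.le_of_forall_lt_iff_le.1 fun q hq => ?_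
    obtain ⟨-, t, -, ht, -, h2⟩ := h (q - r) (sub_pos.2 (EReal.coe_lt_coe_iff.1 hq))
    refine le_trans (b := ((I t : ℝ) : EReal)) (sInf_le ⟨fun _ => t, fun _ _ => le_rfl,
      fun z => ?_, iSup_const.symm⟩) (EReal.coe_le_coe_iff.2 (by linarith))
    rw [iSup_const]
    exact EReal.coe_le_coe_iff.2 (ht z)
  · refine le_sInf ?_
    rintro _ ⟨φ, hφ, hg, rfl⟩
    refine EReal.ge_of_forall_gt_iff_ge.1 fun q hq => ?_
    obtain ⟨s, -, hs, -, h1, -⟩ := h (r - q) (sub_pos.2 (EReal.coe_lt_coe_iff.1 hq))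
    refine le_trans (EReal.coe_le_coe_iff.2 (by linarith)) (hI.le_iSup_of_le_iSup s hφ fun z =>
      (EReal.coe_le_coe_iff.2 (hs z)).trans (hg z))

theorem mem_integrableFunctions (hI : IsDaniellIntegral I) (h : IsSqueezed I g r) :
    g ∈ integrableFunctions I := by
  refine ⟨r, h.upperIntegral_eq hI, ?_⟩
  rw [lowerIntegral, h.neg.upperIntegral_eq hI, EReal.coe_neg, neg_neg]

theorem extendedIntegral_eq (hI : IsDaniellIntegral I) (h : IsSqueezed I g r) :
    extendedIntegral I g = r := by
  rw [extendedIntegral, h.upperIntegral_eq hI, EReal.toReal_coe]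

theorem exists_of_forall (hI : IsDaniellIntegral I)
    (h : ∀ ε : ℝ, 0 < ε → ∃ s t : R, (s : Z → ℝ) ≤ g ∧ g ≤ t ∧ I t - I s ≤ ε) :
    ∃ r, IsSqueezed I g r := by
  obtain ⟨s₀, t₀, hs₀, ht₀, -⟩ := h 1 one_pos
  let A : Set ℝ := {a | ∃ s : R, (s : Z → ℝ) ≤ g ∧ I s = a}
  have hle : ∀ t : R, g ≤ t → ∀ a ∈ A, a ≤ I t := by
    rintro t ht _ ⟨s, hs, rfl⟩
    exact hI.mono (hs.trans ht)
  have hA : A.Nonempty := ⟨_, s₀, hs₀, rfl⟩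
  refine ⟨sSup A, fun ε hε => ?_⟩
  obtain ⟨s, t, hs, ht, hst⟩ := h ε hε
  have h1 : I s ≤ sSup A := le_csSup ⟨_, hle t₀ ht₀⟩ ⟨s, hs, rfl⟩
  have h2 : sSup A ≤ I t := csSup_le hA (hle t ht)
  exact ⟨s, t, hs, ht, by linarith, by linarith⟩

/-- Monotone convergence for decreasing sequences of squeezed functions. -/
theorem isGLB_zero (hI : IsDaniellIntegral I) {g : ℕ → Z → ℝ} {r : ℕ → ℝ}
    (h : ∀ n, IsSqueezed I (g n) (r n)) (hg : ∀ n, 0 ≤ g n) (hanti : ∀ n, g (n + 1) ≤ g n)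
    (hglb : ∀ z, IsGLB (Set.range fun n => g n z) 0) : IsGLB (Set.range r) 0 := by
  refine ⟨?_, fun b hb => ?_⟩
  · rintro _ ⟨n, rfl⟩
    simpa using (of_mem (I := I) 0).mono hI (h n) (hg n)
  refine le_of_forall_pos_le_add fun ε hε => ?_
  -- Minorants s n of g n with errors ε/4 · 2⁻ⁿ, whose sum is ε/2; the running minima m n make them
  -- decreasing.
  choose s hs hsr using fun n : ℕ => (h n (ε / 4 / 2 ^ n) (by positivity)).imp
    fun _ ⟨_, h1, _, h2, _⟩ => And.intro h1 h2
  let m : ℕ → R := fun n => Nat.rec (motive := fun _ => R) (s 0)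
    (fun n f => ⟨(f : Z → ℝ) ⊓ s (n + 1), hI.inf_mem f.2 (s (n + 1)).2⟩) n
  have hm0 : m 0 = s 0 := rfl
  have hm : ∀ n, (m (n + 1) : Z → ℝ) = (m n : Z → ℝ) ⊓ s (n + 1) := fun _ => rfl
  have hmg : ∀ n, (m n : Z → ℝ) ≤ g n := by
    rintro (_ | n)
    · exact hs 0
    · rw [hm]
      exact inf_le_right.trans (hs _)
  -- The loss is the partial sum of the errors. In the induction, m n ⊔ s (n + 1) ≤ g n, so the
  -- identity inf + sup = sum adds only the new error.
  have hmr : ∀ n, r n - (ε / 2 - ε / 4 / 2 ^ n) ≤ I (m n) := by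
    intro n
    induction n with
    | zero =>
      have := hsr 0
      rw [hm0]
      simp only [pow_zero, div_one] at this ⊢
      linarith
    | succ n ih =>
      let w : R := ⟨(m n : Z → ℝ) ⊔ s (n + 1), hI.sup_mem (m n).2 (s _).2⟩
      have e : m (n + 1) + w = m n + s (n + 1) := Subtype.ext (inf_add_sup _ _)
      have e' := congrArg I e
      rw [map_add, map_add] at e'
      have hw : I w ≤ r n := (of_mem w).mono hI (h n) (sup_le (hmg n) ((hs _).trans (hanti n)))
      have h1 := hsr (n + 1)
      have h2 : ε / 4 / 2 ^ n = 2 * (ε / 4 / 2 ^ (n + 1)) := by rw [pow_succ]; field_simp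
      linarith
  let p : ℕ → R := fun n => ⟨(m n : Z → ℝ) ⊔ 0, hI.sup_mem (m n).2 R.zero_mem⟩
  have hp : ∀ n z, (p n : Z → ℝ) z = max ((m n : Z → ℝ) z) 0 := fun _ _ => rfl
  have hpz := hI.continuity p (fun n z => by rw [hp]; exact le_max_right _ _)
    (fun n z => max_le_max ((hm n).le.trans inf_le_left z) le_rfl) (fun z => by
      refine ⟨?_, fun c hc => (hglb z).2 ?_⟩
      · rintro _ ⟨n, rfl⟩
        exact le_max_right _ _
      · rintro _ ⟨n, rfl⟩
        exact (hc ⟨n, rfl⟩).trans (max_le (hmg n z) (hg n z)))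
  have h3 : b - ε ≤ 0 := hpz.2 (by
    rintro _ ⟨n, rfl⟩
    have h1 : I (m n) ≤ I (p n) := hI.mono le_sup_left
    have h2 := hmr n
    have h4 : 0 < ε / 4 / 2 ^ n := by positivity
    have h5 : b ≤ r n := hb ⟨n, rfl⟩
    simp only
    linarith)
  linarith

end IsSqueezed
-- Sections and partial integrals
theorem abs_mem_rieszSpan {Z : Type*} {M : Set (Z → ℝ)} {f : Z → ℝ} (hf : f ∈ rieszSpan M) :
    |f| ∈ rieszSpan M :=
  Submodule.mem_sInf.2 fun R hR => hR.2 f (Submodule.mem_sInf.1 hf R hR)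

section Sections

variable {X Y : Type*} {S : Submodule ℝ (X → ℝ)} {T : Submodule ℝ (Y → ℝ)}

theorem tensorSpace_le_productSpace : tensorSpace S T ≤ productSpace S T :=
  Submodule.span_le.2 fun _ ⟨_, hf, _, hg, h⟩ => h ▸ tensorFun_mem_productSpace hf hg

/-- The functions whose section at x lies in T form a Riesz space containing S ⊗ T. -/
theorem section_snd_mem (hT : ∀ f ∈ T, |f| ∈ T) (f : productSpace S T) (x : X) :
    (fun y => (f : X × Y → ℝ) (x, y)) ∈ T := by
  let V : Submodule ℝ (X × Y → ℝ) := T.comap (LinearMap.funLeft ℝ ℝ fun y => (x, y))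
  have : productSpace S T ≤ V := by
    refine sInf_le ⟨Submodule.span_le.2 ?_, fun g hg => hT _ hg⟩
    rintro _ ⟨a, -, b, hb, rfl⟩
    exact T.smul_mem (a x) hb
  exact this f.2

theorem section_fst_mem (hS : ∀ f ∈ S, |f| ∈ S) (f : productSpace S T) (y : Y) :
    (fun x => (f : X × Y → ℝ) (x, y)) ∈ S := by
  let V : Submodule ℝ (X × Y → ℝ) := S.comap (LinearMap.funLeft ℝ ℝ fun x => (x, y))
  have : productSpace S T ≤ V := by
    refine sInf_le ⟨Submodule.span_le.2 ?_, fun g hg => hS _ hg⟩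
    rintro _ ⟨a, ha, b, -, rfl⟩
    have : b y • a ∈ S := S.smul_mem (b y) ha
    have e : b y • a = fun x => tensorFun a b (x, y) := funext fun x => mul_comm _ _
    rw [e] at this
    exact this
  exact this f.2

/-- Partial integration of functions in the product space in the second variable. -/
def sndIntegral (hT : ∀ f ∈ T, |f| ∈ T) (K : T →ₗ[ℝ] ℝ) : productSpace S T →ₗ[ℝ] (X → ℝ) where
  toFun f x := K ⟨_, section_snd_mem hT f x⟩
  map_add' f g := funext fun x =>
    K.map_add ⟨_, section_snd_mem hT f x⟩ ⟨_, section_snd_mem hT g x⟩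
  map_smul' c f := funext fun x => K.map_smul c ⟨_, section_snd_mem hT f x⟩

/-- Partial integration of functions in the product space in the first variable. -/
def fstIntegral (hS : ∀ f ∈ S, |f| ∈ S) (J : S →ₗ[ℝ] ℝ) : productSpace S T →ₗ[ℝ] (Y → ℝ) where
  toFun f y := J ⟨_, section_fst_mem hS f y⟩
  map_add' f g := funext fun y =>
    J.map_add ⟨_, section_fst_mem hS f y⟩ ⟨_, section_fst_mem hS g y⟩
  map_smul' c f := funext fun y => J.map_smul c ⟨_, section_fst_mem hS f y⟩

theorem sndIntegral_tensorFun (hT : ∀ f ∈ T, |f| ∈ T) (K : T →ₗ[ℝ] ℝ) (f : S) (g : T) :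
    sndIntegral hT K ⟨tensorFun f g, tensorFun_mem_productSpace f.2 g.2⟩ =
      ((K g • f : S) : X → ℝ) := by
  ext x
  exact (K.map_smul ((f : X → ℝ) x) g).trans (mul_comm _ _)

theorem fstIntegral_tensorFun (hS : ∀ f ∈ S, |f| ∈ S) (J : S →ₗ[ℝ] ℝ) (f : S) (g : T) :
    fstIntegral hS J ⟨tensorFun f g, tensorFun_mem_productSpace f.2 g.2⟩ =
      ((J f • g : T) : Y → ℝ) := by
  ext y
  have e : (⟨_, section_fst_mem hS ⟨tensorFun f g, tensorFun_mem_productSpace f.2 g.2⟩ y⟩ : S) =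
      (g : Y → ℝ) y • f := Subtype.ext (funext fun x => mul_comm _ _)
  exact (congrArg J e).trans ((J.map_smul _ f).trans (mul_comm _ _))

theorem sndIntegral_mono {K : T →ₗ[ℝ] ℝ} (hK : IsDaniellIntegral K) {f g : productSpace S T}
    (h : (f : X × Y → ℝ) ≤ g) : sndIntegral hK.abs_mem K f ≤ sndIntegral hK.abs_mem K g :=
  fun x => hK.mono fun y => h (x, y)

theorem fstIntegral_mono {J : S →ₗ[ℝ] ℝ} (hJ : IsDaniellIntegral J) {f g : productSpace S T}
    (h : (f : X × Y → ℝ) ≤ g) : fstIntegral hJ.abs_mem J f ≤ fstIntegral hJ.abs_mem J g :=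
  fun y => hJ.mono fun x => h (x, y)

theorem integrateSnd_eq {K : T →ₗ[ℝ] ℝ} (hK : IsDaniellIntegral K) (f : productSpace S T) :
    integrateSnd (extendedIntegral K) f = sndIntegral hK.abs_mem K f :=
  funext fun x => (IsSqueezed.of_mem (I := K)
    ⟨_, section_snd_mem hK.abs_mem f x⟩).extendedIntegral_eq hK

theorem integrateFst_eq {J : S →ₗ[ℝ] ℝ} (hJ : IsDaniellIntegral J) (f : productSpace S T) :
    integrateFst (extendedIntegral J) f = fstIntegral hJ.abs_mem J f :=
  funext fun y => (IsSqueezed.of_mem (I := J)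
    ⟨_, section_fst_mem hJ.abs_mem f y⟩).extendedIntegral_eq hJ

/-- Elements of the product space are squeezed between elements `v ± ε w` of the tensor product,
with `w` independent of `ε`. -/
theorem exists_tensor_bounds (hS : ∀ f ∈ S, |f| ∈ S) (hT : ∀ f ∈ T, |f| ∈ T)
    (f : productSpace S T) :
    ∃ (σ : S) (τ : T), ∀ ε : ℝ, 0 < ε → ∃ v : productSpace S T,
      (v : X × Y → ℝ) ∈ tensorSpace S T ∧
      ((v - ε • ⟨tensorFun σ τ, tensorFun_mem_productSpace σ.2 τ.2⟩ : productSpace S T) :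
        X × Y → ℝ) ≤ f ∧
      (f : X × Y → ℝ) ≤ (v + ε • ⟨tensorFun σ τ, tensorFun_mem_productSpace σ.2 τ.2⟩ :
        productSpace S T) := by
  obtain ⟨σ, hσ, τ, hτ, -, -, h⟩ := exists_tensor_approx hS hT f.2
  refine ⟨⟨σ, hσ⟩, ⟨τ, hτ⟩, fun ε hε => ?_⟩
  obtain ⟨v, hv, hfv⟩ := h ε hε
  refine ⟨⟨v, tensorSpace_le_productSpace hv⟩, hv, fun p => ?_, fun p => ?_⟩ <;>
  · have := abs_le.1 (hfv p)
    simp only [Pi.sub_apply, Pi.smul_apply, smul_eq_mul, Submodule.coe_sub, Submodule.coe_add,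
      Submodule.coe_smul, Pi.add_apply] at this ⊢
    linarith

theorem mem_map_of_mem_tensorSpace {Z : Type*} {V : Submodule ℝ (Z → ℝ)}
    (Ψ : productSpace S T →ₗ[ℝ] (Z → ℝ))
    (hΨ : ∀ (f : S) (g : T), Ψ ⟨tensorFun f g, tensorFun_mem_productSpace f.2 g.2⟩ ∈ V)
    {v : productSpace S T} (hv : (v : X × Y → ℝ) ∈ tensorSpace S T) : Ψ v ∈ V := by
  have : tensorSpace S T ≤ (V.comap Ψ).map (productSpace S T).subtype := by
    refine Submodule.span_le.2 ?_
    rintro _ ⟨a, ha, b, hb, rfl⟩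
    exact ⟨_, hΨ ⟨a, ha⟩ ⟨b, hb⟩, rfl⟩
  obtain ⟨w, hw, hwv⟩ := this hv
  rwa [← Subtype.ext hwv]

/-- If `Ψ` is a monotone map on the product space that sends the tensor product to the domain of
`L`, then it sends every function to an integrable one. -/
theorem exists_isSqueezed {Z : Type*} {V : Submodule ℝ (Z → ℝ)} {L : V →ₗ[ℝ] ℝ}
    (hL : IsDaniellIntegral L) (hS : ∀ f ∈ S, |f| ∈ S) (hT : ∀ f ∈ T, |f| ∈ T)
    (Ψ : productSpace S T →ₗ[ℝ] (Z → ℝ))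
    (hmono : ∀ f g : productSpace S T, (f : X × Y → ℝ) ≤ g → Ψ f ≤ Ψ g)
    (hΨ : ∀ (f : S) (g : T), Ψ ⟨tensorFun f g, tensorFun_mem_productSpace f.2 g.2⟩ ∈ V)
    (f : productSpace S T) : ∃ r, IsSqueezed L (Ψ f) r := by
  obtain ⟨σ, τ, h⟩ := exists_tensor_bounds hS hT f
  have hw := hΨ σ τ
  set w : productSpace S T := ⟨tensorFun σ τ, tensorFun_mem_productSpace σ.2 τ.2⟩
  refine IsSqueezed.exists_of_forall hL fun ε hε => ?_
  -- The bounds Ψ v ± δ Ψ w have integrals differing by 2δ L(Ψ w) ≤ ε.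
  let δ := ε / (2 * (|L ⟨Ψ w, hw⟩| + 1))
  have hδ : 0 < δ := by positivity
  obtain ⟨v, hv, h1, h2⟩ := h δ hδ
  have hvV := mem_map_of_mem_tensorSpace Ψ hΨ hv
  refine ⟨⟨Ψ v, hvV⟩ - δ • ⟨Ψ w, hw⟩, ⟨Ψ v, hvV⟩ + δ • ⟨Ψ w, hw⟩, ?_, ?_, ?_⟩
  · simpa using hmono _ _ h1
  · simpa using hmono _ _ h2
  · rw [map_add, map_sub, map_smul, smul_eq_mul]
    have : δ * L ⟨Ψ w, hw⟩ ≤ δ * (|L ⟨Ψ w, hw⟩| + 1) := by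
      gcongr
      linarith [le_abs_self (L ⟨Ψ w, hw⟩)]
    have e : δ * (|L ⟨Ψ w, hw⟩| + 1) = ε / 2 := by simp only [δ]; field_simp
    linarith

/-- Fubini's theorem for a positive functional that agrees with an iterated integral on the tensor
product. -/
theorem isSqueezed_of_tensor {Z : Type*} {V : Submodule ℝ (Z → ℝ)} {L : V →ₗ[ℝ] ℝ}
    (hS : ∀ f ∈ S, |f| ∈ S) (hT : ∀ f ∈ T, |f| ∈ T)
    (Ψ : productSpace S T →ₗ[ℝ] (Z → ℝ))
    (hmono : ∀ f g : productSpace S T, (f : X × Y → ℝ) ≤ g → Ψ f ≤ Ψ g)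
    {I : productSpace S T →ₗ[ℝ] ℝ} (hI : IsDaniellIntegral I)
    (hΨ : ∀ (f : S) (g : T), ∃ h : V,
      Ψ ⟨tensorFun f g, tensorFun_mem_productSpace f.2 g.2⟩ = h ∧
      I ⟨tensorFun f g, tensorFun_mem_productSpace f.2 g.2⟩ = L h)
    (f : productSpace S T) : IsSqueezed L (Ψ f) (I f) := by
  have htensor : ∀ v (hv : v ∈ tensorSpace S T), ∃ h : V,
      Ψ ⟨v, tensorSpace_le_productSpace hv⟩ = h ∧
      I ⟨v, tensorSpace_le_productSpace hv⟩ = L h := by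
    intro v hv
    induction hv using Submodule.span_induction with
    | mem v hv =>
      obtain ⟨a, ha, b, hb, rfl⟩ := hv
      exact hΨ ⟨a, ha⟩ ⟨b, hb⟩
    | zero => exact ⟨0, Ψ.map_zero, I.map_zero.trans L.map_zero.symm⟩
    | add v w hv hw h1 h2 =>
      obtain ⟨h, e1, e2⟩ := h1
      obtain ⟨k, e3, e4⟩ := h2
      refine ⟨h + k, ?_, ?_⟩
      · rw [Submodule.coe_add, ← e1, ← e3, ← map_add]; rfl
      · rw [map_add, ← e2, ← e4, ← map_add]; rfl
    | smul c v hv h1 =>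
      obtain ⟨h, e1, e2⟩ := h1
      refine ⟨c • h, ?_, ?_⟩
      · rw [Submodule.coe_smul, ← e1, ← map_smul]; rfl
      · rw [map_smul, ← e2, ← map_smul]; rfl
  obtain ⟨σ, τ, h⟩ := exists_tensor_bounds hS hT f
  have hwm : tensorFun (σ : X → ℝ) (τ : Y → ℝ) ∈ tensorSpace S T :=
    Submodule.subset_span ⟨σ, σ.2, τ, τ.2, rfl⟩
  set w : productSpace S T := ⟨tensorFun σ τ, tensorFun_mem_productSpace σ.2 τ.2⟩
  intro ε hε
  let δ := ε / (2 * (|I w| + 1))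
  have hδ : 0 < δ := by positivity
  obtain ⟨v, hv, h1, h2⟩ := h δ hδ
  -- I f and the integrals of both bounds all lie within δ I w of I v, hence the factor 2.
  have hδw : 2 * (δ * I w) ≤ ε := by
    have : δ * I w ≤ δ * (|I w| + 1) := by
      gcongr
      linarith [le_abs_self (I w)]
    have e : δ * (|I w| + 1) = ε / 2 := by simp only [δ]; field_simp
    linarith
  obtain ⟨s, es, es'⟩ := htensor _ ((tensorSpace S T).sub_mem hv ((tensorSpace S T).smul_mem δ hwm))
  obtain ⟨t, et, et'⟩ := htensor _ ((tensorSpace S T).add_mem hv ((tensorSpace S T).smul_mem δ hwm))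
  have es'' : I (v - δ • w) = L s := es'
  have et'' : I (v + δ • w) = L t := et'
  have h3 := hI.mono h1
  have h4 := hI.mono h2
  rw [map_sub, map_smul, smul_eq_mul] at es'' h3
  rw [map_add, map_smul, smul_eq_mul] at et'' h4
  exact ⟨s, t, es ▸ hmono _ _ h1, et ▸ hmono _ _ h2, by linarith, by linarith⟩

/-- Iterated integration in the order `y`, `x` gives squeezed functions. -/
theorem exists_isSqueezed_sndIntegral {J : S →ₗ[ℝ] ℝ} {K : T →ₗ[ℝ] ℝ}
    (hJ : IsDaniellIntegral J) (hK : IsDaniellIntegral K) (f : productSpace S T) :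
    ∃ r, IsSqueezed J (sndIntegral hK.abs_mem K f) r :=
  exists_isSqueezed hJ hJ.abs_mem hK.abs_mem _ (fun _ _ => sndIntegral_mono hK)
    (fun f g => by rw [sndIntegral_tensorFun]; exact (K g • f).2) f

end Sections

/-! ### Existence, uniqueness and Fubini's theorem -/

namespace IsProductIntegral

variable {X Y : Type*} {S : Submodule ℝ (X → ℝ)} {T : Submodule ℝ (Y → ℝ)}
  {J : S →ₗ[ℝ] ℝ} {K : T →ₗ[ℝ] ℝ} {I : productSpace S T →ₗ[ℝ] ℝ}

theorem isSqueezed_sndIntegral (hI : IsProductIntegral J K I) (hJ : IsDaniellIntegral J)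
    (hK : IsDaniellIntegral K) (f : productSpace S T) :
    IsSqueezed J (sndIntegral hK.abs_mem K f) (I f) :=
  isSqueezed_of_tensor hJ.abs_mem hK.abs_mem _ (fun _ _ => sndIntegral_mono hK)
    hI.isDaniellIntegral (fun f g => ⟨K g • f, sndIntegral_tensorFun _ K f g, by
      rw [hI.apply_tensor, map_smul, smul_eq_mul, mul_comm]⟩) f

theorem isSqueezed_fstIntegral (hI : IsProductIntegral J K I) (hJ : IsDaniellIntegral J)
    (hK : IsDaniellIntegral K) (f : productSpace S T) :
    IsSqueezed K (fstIntegral hJ.abs_mem J f) (I f) :=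
  isSqueezed_of_tensor hJ.abs_mem hK.abs_mem _ (fun _ _ => fstIntegral_mono hJ)
    hI.isDaniellIntegral (fun f g => ⟨J f • g, fstIntegral_tensorFun _ J f g, by
      rw [hI.apply_tensor, map_smul, smul_eq_mul]⟩) f

end IsProductIntegral

/-- The product integral, defined as an iterated integral. -/
theorem exists_isProductIntegral {X Y : Type*} {S : Submodule ℝ (X → ℝ)}
    {T : Submodule ℝ (Y → ℝ)} {J : S →ₗ[ℝ] ℝ} {K : T →ₗ[ℝ] ℝ} (hJ : IsDaniellIntegral J)
    (hK : IsDaniellIntegral K) : ∃ I : productSpace S T →ₗ[ℝ] ℝ, IsProductIntegral J K I := by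
  choose r hr using exists_isSqueezed_sndIntegral hJ hK
  -- Linearity of the chosen values r follows from uniqueness of the squeezed number.
  have unique : ∀ {g : X → ℝ} {a b : ℝ}, IsSqueezed J g a → IsSqueezed J g b → a = b :=
    fun ha hb => le_antisymm (ha.mono hJ hb le_rfl) (hb.mono hJ ha le_rfl)
  let I : productSpace S T →ₗ[ℝ] ℝ :=
    { toFun := r
      map_add' := fun f g => unique (hr _) (map_add (sndIntegral hK.abs_mem K) f g ▸
        (hr f).add (hr g))
      map_smul' := fun c f => unique (hr _) (map_smul (sndIntegral hK.abs_mem K) c f ▸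
        (hr f).smul c) }
  refine ⟨I, ⟨fun f hf => abs_mem_rieszSpan hf, fun f => ?_, fun f h0 hanti hglb => ?_⟩, ?_⟩
  · exact (hr _).mono hJ (hr _) (sndIntegral_mono hK (le_abs_self (f : X × Y → ℝ)))
  · refine IsSqueezed.isGLB_zero hJ (fun n => hr (f n)) (fun n => ?_)
      (fun n => sndIntegral_mono hK (hanti n)) (fun x => ?_)
    · have := sndIntegral_mono hK (f := 0) (g := f n) (h0 n)
      rwa [map_zero] at this
    -- For fixed x, continuity of K makes the partial integrals decrease to 0 at x.
    · exact hK.continuity (fun n => ⟨_, section_snd_mem hK.abs_mem (f n) x⟩)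
        (fun n y => h0 n (x, y)) (fun n y => hanti n (x, y)) (fun y => hglb (x, y))
  · intro f g
    have h := IsSqueezed.of_mem (I := J) (K g • f)
    rw [← sndIntegral_tensorFun hK.abs_mem] at h
    rw [mul_comm, ← smul_eq_mul, ← map_smul]
    exact unique (hr _) h

theorem theorem2 {X Y : Type*} (S : Submodule ℝ (X → ℝ)) (T : Submodule ℝ (Y → ℝ))
    (J : S →ₗ[ℝ] ℝ) (K : T →ₗ[ℝ] ℝ) (hJ : IsDaniellIntegral J) (hK : IsDaniellIntegral K) :
    (∃! I : productSpace S T →ₗ[ℝ] ℝ, IsProductIntegral J K I) ∧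
    ∀ I : productSpace S T →ₗ[ℝ] ℝ, IsProductIntegral J K I →
      (productSpace S T : Set (X × Y → ℝ)) ⊆
        starSnd (integrableFunctions J) (integrableFunctions K) (extendedIntegral K) ∧
      (productSpace S T : Set (X × Y → ℝ)) ⊆
        starFst (integrableFunctions J) (extendedIntegral J) (integrableFunctions K) ∧
      ∀ f : productSpace S T,
        I f = extendedIntegral J (integrateSnd (extendedIntegral K) f) ∧
        I f = extendedIntegral K (integrateFst (extendedIntegral J) f) := by
  -- The right-hand side does not involve I, so this formula also yields uniqueness.
  have snd : ∀ I : productSpace S T →ₗ[ℝ] ℝ, IsProductIntegral J K I → ∀ f : productSpace S T,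
      I f = extendedIntegral J (integrateSnd (extendedIntegral K) f) := fun I hI f => by
    rw [integrateSnd_eq hK, (hI.isSqueezed_sndIntegral hJ hK f).extendedIntegral_eq hJ]
  obtain ⟨I₀, hI₀⟩ := exists_isProductIntegral hJ hK
  refine ⟨⟨I₀, hI₀, fun I hI => LinearMap.ext fun f => (snd I hI f).trans (snd I₀ hI₀ f).symm⟩,
    fun I hI => ⟨fun f hf => ⟨fun x => ?_, ?_⟩, fun f hf => ⟨fun y => ?_, ?_⟩,
      fun f => ⟨snd I hI f, ?_⟩⟩⟩
  · exact (IsSqueezed.of_mem (I := K)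
      ⟨_, section_snd_mem hK.abs_mem ⟨f, hf⟩ x⟩).mem_integrableFunctions hK
  · exact integrateSnd_eq hK ⟨f, hf⟩ ▸
      (hI.isSqueezed_sndIntegral hJ hK ⟨f, hf⟩).mem_integrableFunctions hJ
  · exact (IsSqueezed.of_mem (I := J)
      ⟨_, section_fst_mem hJ.abs_mem ⟨f, hf⟩ y⟩).mem_integrableFunctions hJ
  · exact integrateFst_eq hJ ⟨f, hf⟩ ▸
      (hI.isSqueezed_fstIntegral hJ hK ⟨f, hf⟩).mem_integrableFunctions hK
  · rw [integrateFst_eq hJ, (hI.isSqueezed_fstIntegral hJ hK f).extendedIntegral_eq hK]
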